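/- **Setting.** An energy harvesting transmitter with a battery of $e_{\max}\in\mathbb N$ energy quanta transmits over $N$ parallel sub-carriers in time slots $k=0,1,2,\dots$. In each slot the vectors of channel gains $(\boldsymbol g,\boldsymbol h)\in\mathcal G\times\mathcal H$ of the legitimate receiver and of the eavesdropper, where $\mathcal G,\mathcal H\subset[0,\infty)^N$ are finite, are drawn i.i.d. over time from a joint pmf (law of $(\boldsymbol G,\boldsymbol H)$), and $B^{(k)}\in\mathbb N$ quanta are harvested, i.i.d. with a given pmf and independent of the channel. The state in slot $k$ is $(E^{(k)},\boldsymbol g^{(k)},\boldsymbol h^{(k)})$ with battery level $E^{(k)}\in\mathcal E=\{0,\dots,e_{\max}\}$. At level $e$ a power allocation vector $\boldsymbol\rho\in[0,\infty)^N$ is feasible if its total power $\rho^{\rm tot}=\sum_{r=1}^N\rho_r$ is an integer number of quanta in $\{0,\dots,e\}$. A policy $\mu$ assigns to every state $(e,\boldsymbol g,\boldsymbol h)$ a pmf $\mu(\cdot\,;e,\boldsymbol g,\boldsymbol h)$ on the vectors feasible at level $e$; in each slot the vector $\boldsymbol\Sigma^{(k)}$ that is used is drawn from it, and $$E^{(k+1)}=\min\Big\{E^{(k)}-\sum_{r=1}^N\Sigma^{(k)}_r+B^{(k)},\;e_{\max}\Big\}.$$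 The instantaneous secrecy rate is $c(\boldsymbol\rho,\boldsymbol g,\boldsymbol h)=\sum_{r=1}^N R_{g_r,h_r}(\rho_r)$, where $R_{g,h}(\rho)=\log_2(1+g\rho)-\log_2(1+\min\{g,h\}\rho)$ for variable rate coding and $R_{g,h}(\rho)=\log_2(1+g\rho)-\log_2(1+h\rho)$ for constant rate coding; either coding strategy may be used. For an initial battery level $E^{(0)}$, the average secrecy rate is $$C_\mu(E^{(0)})=\Big[\liminf_{K\to\infty}\frac1{K+1}\sum_{k=0}^K\mathbb E\,c(\boldsymbol\Sigma^{(k)},\boldsymbol g^{(k)},\boldsymbol h^{(k)})\Big]^+,$$ and its steady-state form is $$\tilde C_\mu(E^{(0)})=\sum_{e\in\mathcal E}\pi_\mu(e\,|\,E^{(0)})\;\mathbb E\Big[\sum_{\boldsymbol\rho}c(\boldsymbol\rho,\boldsymbol G,\boldsymbol H)\,\mu(\boldsymbol\rho;e,\boldsymbol G,\boldsymbol H)\Big],\qquad \pi_\mu(e\,|\,E^{(0)})=\liminf_{K\to\infty}\frac1{K+1}\sum_{k=0}^K\mathbb P(E^{(k)}=e\,|\,E^{(0)}).$$ An optimal secrecy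 policy is a policy that maximizes $C_\mu(E^{(0)})$ and $\tilde C_\mu(E^{(0)})$ over all policies $\mu$, for every initial level $E^{(0)}\in\mathcal E$. **Theorem.** There exists a deterministic optimal secrecy policy, i.e., an optimal secrecy policy $\mu^\star$ such that for every state $(e,\boldsymbol g,\boldsymbol h)$ there is a vector $\boldsymbol\rho^\star_{e,\boldsymbol g,\boldsymbol h}$ with $$\mu^\star(\boldsymbol\rho;e,\boldsymbol g,\boldsymbol h)=\begin{cases}1,&\boldsymbol\rho=\boldsymbol\rho^\star_{e,\boldsymbol g,\boldsymbol h},\\0,&\text{otherwise.}\end{cases}$$ Consequently there are numbers $\rho^{\rm tot\,\star}_{e,\boldsymbol g,\boldsymbol h}$ such that the transmit power policy $\gamma_{\mu^\star}(\cdot\,;e,\boldsymbol g,\boldsymbol h)$, i.e. the conditional law of the total power given the state, satisfies $\gamma_{\mu^\star}(\rho^{\rm tot};e,\boldsymbol g,\boldsymbol h)=1$ if $\rho^{\rm tot}=\rho^{\rm tot\,\star}_{e,\boldsymbol g,\boldsymbol h}$, and $0$ otherwise. -/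

import Mathlib

open Filter

noncomputable section

namespace EHSecrecy

/-- The two coding strategies of the transmitter. -/
inductive Coding where
  | variableRate
  | constantRate

/-- Secrecy rate of one sub-carrier with legitimate gain `g`, eavesdropper gain `h` and
transmission power `p`, in bits. -/
def rate (cod : Coding) (g h p : ℝ) : ℝ :=
  match cod with
  | .variableRate => Real.logb 2 (1 + g * p) - Real.logb 2 (1 + min g h * p)
  | .constantRate => Real.logb 2 (1 + g * p) - Real.logb 2 (1 + h * p)

/-- Data of the energy harvesting transmitter over `N` parallel sub-carriers. In every slot, the
pair of channel gain vectors is drawn from `channelLaw` and the number of harvested quanta from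
`arrivalLaw`, independently of each other and of the past. -/
structure Model (N : ℕ) where
  /-- Battery size. -/
  emax : ℕ
  /-- Finite set of gain vectors of the legitimate channel. -/
  gSet : Finset (Fin N → ℝ)
  /-- Finite set of gain vectors of the eavesdropper's channel. -/
  hSet : Finset (Fin N → ℝ)
  gSet_nonneg : ∀ g ∈ gSet, ∀ r, 0 ≤ g r
  hSet_nonneg : ∀ h ∈ hSet, ∀ r, 0 ≤ h r
  /-- Joint pmf of the two gain vectors (they may be dependent). -/
  channelLaw : PMF (gSet × hSet)
  /-- Pmf of the number of energy quanta harvested in a slot. -/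
  arrivalLaw : PMF ℕ
  /-- Coding strategy. -/
  coding : Coding

variable {N : ℕ}

/-- Energy levels `0, …, emax`. -/
abbrev Model.Level (M : Model N) : Type := Fin (M.emax + 1)

/-- States `(e, g, h)` of the Markov chain. -/
abbrev Model.State (M : Model N) : Type := M.Level × (M.gSet × M.hSet)

/-- Total transmission power of a power allocation vector. -/
def totalPower (ρ : Fin N → ℝ) : ℝ := ∑ r, ρ r

/-- Power allocation vectors that can be used with `e` stored quanta: the powers are nonnegative
reals and their sum is an integer number of quanta not exceeding `e`. -/
def feasible (e : ℕ) : Set (Fin N → ℝ) :=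
  {ρ | (∀ r, 0 ≤ ρ r) ∧ ∃ d : ℕ, d ≤ e ∧ totalPower ρ = d}

/-- The sum of the secrecy rates of the sub-carriers. -/
def Model.contribution (M : Model N) (ρ g h : Fin N → ℝ) : ℝ :=
  ∑ r, rate M.coding (g r) (h r) (ρ r)

/-- A power allocation policy: for every state, a pmf on the feasible power allocation vectors. -/
structure Policy (M : Model N) where
  law : M.State → PMF (Fin N → ℝ)
  support_subset : ∀ s : M.State, (law s).support ⊆ feasible (s.1 : ℕ)

/-- The transmit power policy: the conditional law of the total power given the state. -/
def Policy.transmitPower {M : Model N} (μ : Policy M) (s : M.State) : PMF ℝ :=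
  (μ.law s).map totalPower

/-- Battery update `min (e - ∑ r, ρ r + b) emax`. For feasible `ρ` the total power is a natural
number that is at most `e`, so that neither the floor nor the subtraction loses anything. -/
def Model.nextLevel (M : Model N) (e : M.Level) (ρ : Fin N → ℝ) (b : ℕ) : M.Level :=
  ⟨min ((e : ℕ) - ⌊totalPower ρ⌋₊ + b) M.emax, Nat.lt_succ_of_le (min_le_right _ _)⟩

/-- One transition of the Markov chain `(E, g, h)` under a policy. -/
def Policy.step {M : Model N} (μ : Policy M) (s : M.State) : PMF M.State :=
  (μ.law s).bind fun ρ =>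
    M.arrivalLaw.bind fun b =>
      M.channelLaw.map fun c => (M.nextLevel s.1 ρ b, c)

/-- Law of the state in slot `k` when the initial battery level is `e₀`. -/
def Policy.stateLaw {M : Model N} (μ : Policy M) (e₀ : M.Level) : ℕ → PMF M.State
  | 0 => M.channelLaw.map fun c => (e₀, c)
  | k + 1 => (μ.stateLaw e₀ k).bind μ.step

/-- Expected secrecy rate given the state: `∑ ρ, c(ρ, g, h) μ(ρ; e, g, h)`. -/
def Policy.stateReward {M : Model N} (μ : Policy M) (s : M.State) : ℝ :=
  ∑' ρ : Fin N → ℝ, (μ.law s ρ).toReal * M.contribution ρ s.2.1 s.2.2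

/-- Expected secrecy rate in slot `k`. -/
def Policy.slotReward {M : Model N} (μ : Policy M) (e₀ : M.Level) (k : ℕ) : ℝ :=
  ∑ s : M.State, (μ.stateLaw e₀ k s).toReal * μ.stateReward s

/-- Long-run average secrecy rate: the positive part of the lower limit of the expected
time averages. -/
def Policy.averageRate {M : Model N} (μ : Policy M) (e₀ : M.Level) : ℝ :=
  max 0 (liminf (fun K : ℕ => (∑ k ∈ Finset.range (K + 1), μ.slotReward e₀ k) / ((K : ℝ) + 1))
    atTop)

/-- Probability that the battery level in slot `k` is `e`, given the initial level `e₀`. -/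
def Policy.levelProb {M : Model N} (μ : Policy M) (e₀ : M.Level) (k : ℕ) (e : M.Level) : ℝ :=
  (((μ.stateLaw e₀ k).map Prod.fst) e).toReal

/-- Long-term (steady-state) probability of the battery level `e`, given the initial level. -/
def Policy.steadyState {M : Model N} (μ : Policy M) (e₀ e : M.Level) : ℝ :=
  liminf (fun K : ℕ => (∑ k ∈ Finset.range (K + 1), μ.levelProb e₀ k e) / ((K : ℝ) + 1)) atTop

/-- The reward in steady-state form:
`∑ e, π(e | e₀) 𝔼[∑ ρ, c(ρ, G, H) μ(ρ; e, G, H)]`. -/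
def Policy.steadyRate {M : Model N} (μ : Policy M) (e₀ : M.Level) : ℝ :=
  ∑ e : M.Level, μ.steadyState e₀ e *
    ∑ c : M.gSet × M.hSet, (M.channelLaw c).toReal * μ.stateReward (e, c)

/-- Optimal secrecy policy: it maximizes the long-run average secrecy rate, in both of its forms,
over all policies and from every initial battery level. -/
def Policy.IsOptimal {M : Model N} (μ : Policy M) : Prop :=
  ∀ (e₀ : M.Level) (ν : Policy M),
    ν.averageRate e₀ ≤ μ.averageRate e₀ ∧ ν.steadyRate e₀ ≤ μ.steadyRate e₀

end EHSecrecy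

end

/-! The proof is a vanishing-discount argument combined with a pigeonhole. Channel gains are fresh
in every slot, so the battery level alone is a finite Markov chain, driven only by the total power.
For each state and each total power, compactness gives a best split over the sub-carriers, so
finitely many allocations per state suffice (`exists_dominating_actions`).

For each discount factor `γ < 1`, the Bellman equation has a solution `u` attained by a
deterministic decision among these, and `u` is a supersolution for every policy
(`exists_discounted_optimal`). Writing a policy's reward as `f = a + (T b - b)` with `T a = a`, both
forms of its long-run rate are given by `a`, up to the positive part. Super- and subsolutions
compare `u` with `a` up to `2 * (1 - γ) * ‖b‖`.

There are finitely many decisions, so one is optimal for infinitely many of the factors `1 - 1 / (n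
+ 1)`; letting `n → ∞` along these makes it optimal for the average. -/

noncomputable section

namespace EHSecrecy

/-! ### Mean ergodic theorem in finite dimension. -/

section Ergodic

variable {V : Type*} [NormedAddCommGroup V] [NormedSpace ℝ V]

theorem norm_pow_apply_le {T : V →ₗ[ℝ] V} (hT : ∀ x, ‖T x‖ ≤ ‖x‖) (k : ℕ) (x : V) :
    ‖(T ^ k) x‖ ≤ ‖x‖ := by
  induction k generalizing x with
  | zero => simp
  | succ k ih =>
    rw [pow_succ, Module.End.mul_apply]
    exact (ih _).trans (hT x)

theorem pow_apply_of_fixed {T : V →ₗ[ℝ] V} {a : V} (ha : T a = a) (k : ℕ) : (T ^ k) a = a := by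
  induction k with
  | zero => simp
  | succ k ih => rw [pow_succ, Module.End.mul_apply, ha, ih]

theorem sum_pow_apply_coboundary (T : V →ₗ[ℝ] V) (b : V) (n : ℕ) :
    ∑ k ∈ Finset.range n, (T ^ k) (T b - b) = (T ^ n) b - b := by
  induction n with
  | zero => simp
  | succ n ih =>
    rw [Finset.sum_range_succ, ih, map_sub, pow_succ, Module.End.mul_apply]
    abel

/-- If the values of the sums `n • v` stay bounded, then `v = 0`. -/
theorem eq_zero_of_norm_nsmul_le {v : V} {C : ℝ} (h : ∀ n : ℕ, ‖n • v‖ ≤ C) : v = 0 := by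
  by_contra hv
  have hv' : 0 < ‖v‖ := norm_pos_iff.mpr hv
  obtain ⟨n, hn⟩ := exists_nat_gt (C / ‖v‖)
  have h1 := h n
  rw [← Nat.cast_smul_eq_nsmul ℝ, norm_smul, Real.norm_natCast] at h1
  rw [div_lt_iff₀ hv'] at hn
  linarith

/-- Mean ergodic decomposition for a contraction of a finite-dimensional space. -/
theorem exists_fixed_add_coboundary [FiniteDimensional ℝ V] {T : V →ₗ[ℝ] V}
    (hT : ∀ x, ‖T x‖ ≤ ‖x‖) (f : V) : ∃ a b, T a = a ∧ f = a + (T b - b) := by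
  -- A fixed vector `v = T y - y` satisfies `n • v = T ^ n y - y`, which is bounded in `n`, so `v =
  -- 0`. Rank-nullity then makes kernel and range of `T - 1` complementary.
  have hdisj : Disjoint (LinearMap.ker (T - 1)) (LinearMap.range (T - 1)) := by
    rw [Submodule.disjoint_def]
    rintro v hv ⟨y, rfl⟩
    have hfix : T (T y - y) = T y - y := by
      simpa [sub_eq_zero] using hv
    have : T y - y = 0 := by
      refine eq_zero_of_norm_nsmul_le (C := 2 * ‖y‖) fun n => ?_
      have h := sum_pow_apply_coboundary T y n
      rw [Finset.sum_congr rfl fun k _ => pow_apply_of_fixed hfix k, Finset.sum_const,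
        Finset.card_range] at h
      rw [h]
      have := norm_sub_le ((T ^ n) y) y
      have := norm_pow_apply_le hT n y
      linarith
    simpa using this
  have htop := Submodule.eq_top_of_disjoint _ _
    (by rw [add_comm]; exact (LinearMap.finrank_range_add_finrank_ker (T - 1)).ge) hdisj
  obtain ⟨a, ha, c, ⟨b, rfl⟩, hf⟩ := Submodule.mem_sup.mp (htop ▸ Submodule.mem_top : f ∈ _)
  exact ⟨a, b, by simpa [sub_eq_zero] using ha, by simpa using hf.symm⟩

/-- The coboundary part telescopes to at most `2 * ‖b‖`, which the averaging kills. -/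
theorem tendsto_cesaro_of_decomposition {T : V →ₗ[ℝ] V} (hT : ∀ x, ‖T x‖ ≤ ‖x‖) {f a b : V}
    (ha : T a = a) (hf : f = a + (T b - b)) :
    Tendsto (fun K : ℕ => ((K : ℝ) + 1)⁻¹ • ∑ k ∈ Finset.range (K + 1), (T ^ k) f) atTop
      (nhds a) := by
  have hsum : ∀ K : ℕ, ((K : ℝ) + 1)⁻¹ • ∑ k ∈ Finset.range (K + 1), (T ^ k) f
      = a + ((K : ℝ) + 1)⁻¹ • ((T ^ (K + 1)) b - b) := by
    intro K
    have hK : (K : ℝ) + 1 ≠ 0 := by positivity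
    rw [hf]
    simp_rw [map_add (T ^ _) a]
    rw [Finset.sum_add_distrib, sum_pow_apply_coboundary,
      Finset.sum_congr rfl fun k _ => pow_apply_of_fixed ha k, Finset.sum_const,
      Finset.card_range, smul_add, ← Nat.cast_smul_eq_nsmul ℝ, smul_smul]
    push_cast
    rw [inv_mul_cancel₀ hK, one_smul]
  simp_rw [hsum]
  conv => rhs; rw [← add_zero a]
  refine tendsto_const_nhds.add ?_
  refine squeeze_zero_norm (a := fun K : ℕ => 2 * ‖b‖ * (1 / ((K : ℝ) + 1))) (fun K => ?_) ?_
  · rw [norm_smul, norm_inv, Real.norm_of_nonneg (by positivity : (0 : ℝ) ≤ (K : ℝ) + 1),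
      one_div, mul_comm]
    gcongr
    have := norm_sub_le ((T ^ (K + 1)) b) b
    have := norm_pow_apply_le hT (K + 1) b
    linarith
  · simpa using (tendsto_one_div_add_atTop_nhds_zero_nat (𝕜 := ℝ)).const_mul (2 * ‖b‖)

end Ergodic

/-! ### Expectations, transition operators and discounted comparison. -/

section Expectation

variable {α β S : Type*} [Fintype β] [Fintype S]

/-- Expectation of a function on a finite type. -/
def expect (p : PMF β) (f : β → ℝ) : ℝ := ∑ x, (p x).toReal * f x

theorem summable_toReal (p : PMF α) : Summable fun x => (p x).toReal :=
  ENNReal.summable_toReal p.tsum_coe_ne_top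

theorem tsum_toReal (p : PMF α) : ∑' x, (p x).toReal = 1 := by
  rw [← ENNReal.tsum_toReal_eq fun x => p.apply_ne_top x, p.tsum_coe, ENNReal.toReal_one]

theorem sum_toReal (p : PMF β) : ∑ x, (p x).toReal = 1 := by
  rw [← tsum_fintype (L := .unconditional β), tsum_toReal]

theorem summable_toReal_mul (p : PMF α) {f : α → ℝ} {C : ℝ}
    (hf : ∀ x ∈ p.support, |f x| ≤ C) : Summable fun x => (p x).toReal * f x := by
  refine Summable.of_norm_bounded ((summable_toReal p).mul_right C) fun x => ?_
  rw [norm_mul, Real.norm_of_nonneg ENNReal.toReal_nonneg, Real.norm_eq_abs]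
  by_cases hx : x ∈ p.support
  · exact mul_le_mul_of_nonneg_left (hf x hx) ENNReal.toReal_nonneg
  · simp [(p.apply_eq_zero_iff x).mpr hx]

theorem tsum_toReal_mul_le (p : PMF α) {f : α → ℝ} {C : ℝ}
    (hs : Summable fun x => (p x).toReal * f x) (hf : ∀ x ∈ p.support, f x ≤ C) :
    ∑' x, (p x).toReal * f x ≤ C := by
  calc ∑' x, (p x).toReal * f x ≤ ∑' x, (p x).toReal * C := by
        refine hs.tsum_le_tsum (fun x => ?_) ((summable_toReal p).mul_right C)
        by_cases hx : x ∈ p.support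
        · exact mul_le_mul_of_nonneg_left (hf x hx) ENNReal.toReal_nonneg
        · simp [(p.apply_eq_zero_iff x).mpr hx]
    _ = C := by rw [tsum_mul_right, tsum_toReal, one_mul]

theorem expect_mono (p : PMF β) {f g : β → ℝ} (h : ∀ x, f x ≤ g x) : expect p f ≤ expect p g :=
  Finset.sum_le_sum fun x _ => mul_le_mul_of_nonneg_left (h x) ENNReal.toReal_nonneg

theorem expect_const (p : PMF β) (c : ℝ) : expect p (fun _ => c) = c := by
  rw [expect, ← Finset.sum_mul, sum_toReal, one_mul]

theorem expect_add (p : PMF β) (f g : β → ℝ) : expect p (f + g) = expect p f + expect p g := by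
  simp [expect, mul_add, Finset.sum_add_distrib]

theorem expect_smul (p : PMF β) (c : ℝ) (f : β → ℝ) : expect p (c • f) = c * expect p f := by
  simp only [expect, Pi.smul_apply, smul_eq_mul, Finset.mul_sum]
  exact Finset.sum_congr rfl fun x _ => by ring

theorem abs_expect_le (p : PMF β) (f : β → ℝ) : |expect p f| ≤ ‖f‖ := by
  rw [abs_le]
  constructor
  · rw [← expect_const p (-‖f‖)]
    exact expect_mono p fun x => neg_le_of_abs_le (norm_le_pi_norm f x)
  · conv_rhs => rw [← expect_const p ‖f‖]
    exact expect_mono p fun x => le_of_abs_le (norm_le_pi_norm f x)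

theorem expect_pure (x : β) (f : β → ℝ) : expect (PMF.pure x) f = f x := by
  classical
  rw [expect, Finset.sum_eq_single x]
  · simp [PMF.pure_apply]
  · intro y _ hy
    simp [PMF.pure_apply, hy]
  · simp

theorem expect_single [DecidableEq β] (p : PMF β) (x : β) :
    expect p (Pi.single x 1) = (p x).toReal := by
  rw [expect, Finset.sum_eq_single x] <;> simp +contextual

/-- `α` may be infinite, as needed for pmfs on power vectors; only the target is finite. -/
theorem expect_bind_eq_tsum (p : PMF α) (k : α → PMF β) (f : β → ℝ) :
    expect (p.bind k) f = ∑' x, (p x).toReal * expect (k x) f := by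
  simp only [expect, PMF.bind_apply, Finset.mul_sum]
  rw [Summable.tsum_finsetSum]
  · refine Finset.sum_congr rfl fun y _ => ?_
    rw [ENNReal.tsum_toReal_eq, ← tsum_mul_right]
    · exact tsum_congr fun x => by rw [ENNReal.toReal_mul, mul_assoc]
    · exact fun x => ENNReal.mul_ne_top (p.apply_ne_top x) ((k x).apply_ne_top y)
  · intro y _
    refine summable_toReal_mul p (C := |f y|) fun x _ => ?_
    rw [abs_mul, abs_of_nonneg ENNReal.toReal_nonneg]
    refine mul_le_of_le_one_left (abs_nonneg _) ?_
    simpa using ENNReal.toReal_mono ENNReal.one_ne_top ((k x).coe_le_one y)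

theorem expect_bind (p : PMF S) (k : S → PMF β) (f : β → ℝ) :
    expect (p.bind k) f = expect p fun x => expect (k x) f := by
  rw [expect_bind_eq_tsum, tsum_fintype, expect]

theorem expect_map (p : PMF S) (k : S → β) (f : β → ℝ) :
    expect (p.map k) f = expect p fun x => f (k x) := by
  rw [PMF.map, expect_bind]
  simp [expect_pure]

/-- The transition operator of a finite Markov chain. -/
def transition (K : S → PMF S) : (S → ℝ) →ₗ[ℝ] (S → ℝ) where
  toFun f e := expect (K e) f
  map_add' f g := funext fun e => expect_add (K e) f g
  map_smul' c f := funext fun e => expect_smul (K e) c f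

@[simp] theorem transition_apply (K : S → PMF S) (f : S → ℝ) (e : S) :
    transition K f e = expect (K e) f := rfl

theorem norm_transition_le (K : S → PMF S) (f : S → ℝ) : ‖transition K f‖ ≤ ‖f‖ :=
  (pi_norm_le_iff_of_nonneg (norm_nonneg f)).mpr fun e => abs_expect_le (K e) f

/-- A discounted supersolution dominates the long-run average up to an error proportional to
`1 - γ`. -/
theorem le_of_discounted_supersolution {K : S → PMF S} {γ : ℝ} (h0 : 0 ≤ γ) (h1 : γ < 1)
    {u f a b : S → ℝ} (ha : transition K a = a) (hf : f = a + (transition K b - b))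
    (hu : ∀ e, (1 - γ) * f e + γ * expect (K e) u ≤ u e) (e : S) :
    a e - 2 * (1 - γ) * ‖b‖ ≤ u e := by
  have hγ : 0 < 1 - γ := sub_pos.mpr h1
  -- In terms of `y`, the terms in `a` cancel and one factor `1 - γ` divides out, leaving `(1 - γ) *
  -- T b + γ * T y ≤ y`. A minimum principle then bounds `y` below by `-‖b‖`.
  obtain ⟨y, hy⟩ : ∃ y : S → ℝ, u = a + (1 - γ) • (y - b) :=
    ⟨(1 - γ)⁻¹ • (u - a) + b, by
      rw [add_sub_cancel_right, smul_smul, mul_inv_cancel₀ hγ.ne', one_smul,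
        add_sub_cancel]⟩
  have hy' : ∀ e, (1 - γ) * expect (K e) b + γ * expect (K e) y ≤ y e := by
    intro e
    have h := hu e
    have e1 : expect (K e) u = a e + (1 - γ) * (expect (K e) y - expect (K e) b) := by
      have := congrFun (congrArg (transition K) hy) e
      rw [map_add, map_smul, map_sub, ha] at this
      simpa using this
    have e2 : f e = a e + (expect (K e) b - b e) := by rw [hf]; rfl
    have e3 : u e = a e + (1 - γ) * (y e - b e) := by rw [hy]; rfl
    rw [e1, e2, e3] at h
    have : (1 - γ) * ((1 - γ) * expect (K e) b + γ * expect (K e) y) ≤ (1 - γ) * y e := by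
      linarith
    exact le_of_mul_le_mul_left this hγ
  have : Nonempty S := ⟨e⟩
  obtain ⟨m, hm⟩ := Finite.exists_min y
  have hmin : y m ≤ expect (K m) y := by
    conv_lhs => rw [← expect_const (K m) (y m)]
    exact expect_mono _ hm
  have hb : -‖b‖ ≤ expect (K m) b := neg_le_of_abs_le (abs_expect_le _ _)
  have hym : -‖b‖ ≤ y m := by
    have h2 := hy' m
    have h3 := mul_le_mul_of_nonneg_left hmin h0
    have h4 := mul_le_mul_of_nonneg_left hb hγ.le
    have : (1 - γ) * -‖b‖ ≤ (1 - γ) * y m := by linarith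
    exact le_of_mul_le_mul_left this hγ
  have hbe : b e ≤ ‖b‖ := le_of_abs_le (norm_le_pi_norm b e)
  have e3 : u e = a e + (1 - γ) * (y e - b e) := by rw [hy]; rfl
  have : (1 - γ) * (-(2 * ‖b‖)) ≤ (1 - γ) * (y e - b e) :=
    mul_le_mul_of_nonneg_left (by linarith [hm e]) hγ.le
  rw [e3]
  linarith

theorem le_of_discounted_subsolution {K : S → PMF S} {γ : ℝ} (h0 : 0 ≤ γ) (h1 : γ < 1)
    {u f a b : S → ℝ} (ha : transition K a = a) (hf : f = a + (transition K b - b))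
    (hu : ∀ e, u e ≤ (1 - γ) * f e + γ * expect (K e) u) (e : S) :
    u e ≤ a e + 2 * (1 - γ) * ‖b‖ := by
  have h := le_of_discounted_supersolution (K := K) h0 h1 (u := -u) (f := -f) (a := -a) (b := -b)
    (by rw [map_neg, ha]) (by rw [hf, map_neg]; abel)
    (fun e => by
      have h2 : expect (K e) (-u) = -expect (K e) u := congrFun (map_neg (transition K) u) e
      have := hu e
      rw [h2, Pi.neg_apply, Pi.neg_apply]
      linarith) e
  rw [norm_neg, Pi.neg_apply, Pi.neg_apply] at h
  linarith

end Expectation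

/-! ### Discounted Bellman equation by Banach's fixed point theorem. -/

section Bellman

/-- Discounted optimality equation of a finite decision process in which an independent signal
`c` with law `p` is observed before the action is chosen. -/
theorem exists_bellman_solution {S C A : Type*} [Fintype S] [Fintype C] (p : PMF C)
    (act : S → C → Finset A) (hact : ∀ e c, (act e c).Nonempty) (r : S → C → A → ℝ)
    (q : S → A → PMF S) {γ : ℝ} (h0 : 0 ≤ γ) (h1 : γ < 1) :
    ∃ u : S → ℝ, ∀ e, u e = expect p fun c => (act e c).sup' (hact e c) fun x =>
      (1 - γ) * r e c x + γ * expect (q e x) u := by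
  let Φ : (S → ℝ) → (S → ℝ) := fun u e => expect p fun c => (act e c).sup' (hact e c) fun x =>
      (1 - γ) * r e c x + γ * expect (q e x) u
  have key : ∀ u v : S → ℝ, ∀ e, Φ u e ≤ Φ v e + γ * ‖u - v‖ := by
    intro u v e
    rw [← expect_const p (γ * ‖u - v‖), ← expect_add]
    refine expect_mono p fun c => Finset.sup'_le _ _ fun x hx => ?_
    have hle := Finset.le_sup' (fun x => (1 - γ) * r e c x + γ * expect (q e x) v) hx
    have hd : expect (q e x) u ≤ expect (q e x) v + ‖u - v‖ := by
      conv_rhs => rw [← expect_const (q e x) ‖u - v‖, ← expect_add]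
      refine expect_mono _ fun s => ?_
      have := le_of_abs_le (norm_le_pi_norm (u - v) s)
      simp only [Pi.sub_apply, Pi.add_apply] at this ⊢
      linarith
    have := mul_le_mul_of_nonneg_left hd h0
    simp only [Pi.add_apply]
    linarith
  have hΦ : ContractingWith ⟨γ, h0⟩ Φ := by
    refine ⟨by exact_mod_cast h1, LipschitzWith.of_dist_le_mul fun u v => ?_⟩
    rw [dist_eq_norm, dist_eq_norm]
    refine (pi_norm_le_iff_of_nonneg (mul_nonneg h0 (norm_nonneg _))).mpr fun e => ?_
    have h2 := key u v e
    have h3 := key v u e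
    rw [norm_sub_rev] at h3
    rw [Pi.sub_apply, Real.norm_eq_abs]
    change |Φ u e - Φ v e| ≤ γ * ‖u - v‖
    rw [abs_le]
    constructor <;> linarith
  exact ⟨ContractingWith.fixedPoint Φ hΦ, fun e => (congrFun hΦ.fixedPoint_isFixedPt e).symm⟩

end Bellman

variable {N : ℕ}

/-! ### Compactness and reduction to finitely many allocations. -/

section Rate

/-- Nonnegative gains and powers keep every logarithm's argument at least `1`. -/
theorem continuousOn_contribution (M : Model N) (c : M.gSet × M.hSet) :
    ContinuousOn (fun ρ => M.contribution ρ c.1 c.2) {ρ : Fin N → ℝ | ∀ r, 0 ≤ ρ r} := by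
  have hlog : ∀ (x : ℝ) (r : Fin N), 0 ≤ x →
      ContinuousOn (fun ρ : Fin N → ℝ => Real.logb 2 (1 + x * ρ r)) {ρ | ∀ r, 0 ≤ ρ r} := by
    intro x r hx
    simp only [Real.logb]
    refine ContinuousOn.div_const (ContinuousOn.log (by fun_prop) fun ρ hρ => ?_) _
    have := mul_nonneg hx (hρ r)
    positivity
  refine continuousOn_finsetSum _ fun r _ => ?_
  have hg := M.gSet_nonneg _ c.1.2 r
  have hh := M.hSet_nonneg _ c.2.2 r
  cases hc : M.coding with
  | variableRate => exact (hlog _ r hg).sub (hlog _ r (le_min hg hh))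
  | constantRate => exact (hlog _ r hg).sub (hlog _ r hh)

theorem isCompact_totalPower_eq (N d : ℕ) :
    IsCompact {ρ : Fin N → ℝ | (∀ r, 0 ≤ ρ r) ∧ totalPower ρ = d} := by
  refine (isCompact_univ_pi fun _ : Fin N => isCompact_Icc (a := (0 : ℝ)) (b := d)).of_isClosed_subset
    ?_ ?_
  · exact (isClosed_le (continuous_const (y := (0 : Fin N → ℝ))) continuous_id).inter
      (isClosed_eq (by unfold totalPower; fun_prop) continuous_const)
  · rintro ρ ⟨h, hd⟩ r -
    exact ⟨h r, hd ▸ Finset.single_le_sum (fun i _ => h i) (Finset.mem_univ r)⟩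

theorem feasible_eq_biUnion (e : ℕ) : feasible (N := N) e =
    ⋃ d ∈ Finset.range (e + 1), {ρ | (∀ r, 0 ≤ ρ r) ∧ totalPower ρ = d} := by
  ext ρ
  simp only [feasible, Set.mem_ofPred_eq, Set.mem_iUnion, Finset.mem_range, Nat.lt_succ_iff]
  constructor
  · rintro ⟨h, d, hd, ht⟩
    exact ⟨d, hd, h, ht⟩
  · rintro ⟨d, hd, h, ht⟩
    exact ⟨h, d, hd, ht⟩

theorem isCompact_feasible (N e : ℕ) : IsCompact (feasible (N := N) e) := by
  rw [feasible_eq_biUnion]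
  exact (Finset.range (e + 1)).isCompact_biUnion fun d _ => isCompact_totalPower_eq N d

theorem zero_mem_feasible (e : ℕ) : (0 : Fin N → ℝ) ∈ feasible e :=
  ⟨fun _ => le_rfl, 0, Nat.zero_le _, by simp [totalPower]⟩

theorem exists_contribution_bound (M : Model N) (s : M.State) :
    ∃ C, ∀ ρ ∈ feasible (s.1 : ℕ), |M.contribution ρ s.2.1 s.2.2| ≤ C :=
  (isCompact_feasible N s.1).exists_bound_of_continuousOn
    ((continuousOn_contribution M s.2).mono fun _ h => h.1)

/-- In every state, finitely many allocations suffice: one maximizer for each total power. -/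
theorem exists_dominating_actions (M : Model N) (s : M.State) :
    ∃ A : Finset (Fin N → ℝ), A.Nonempty ∧ (↑A ⊆ feasible (N := N) (s.1 : ℕ)) ∧
      ∀ ρ ∈ feasible (s.1 : ℕ), ∃ ρ' ∈ A, totalPower ρ' = totalPower ρ ∧
        M.contribution ρ s.2.1 s.2.2 ≤ M.contribution ρ' s.2.1 s.2.2 := by
  classical
  have hmax : ∀ d : ℕ, ∃ x : Fin N → ℝ,
      ∀ ρ : Fin N → ℝ, (∀ r, 0 ≤ ρ r) → totalPower ρ = d → (∀ r, 0 ≤ x r) ∧ totalPower x = d ∧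
        M.contribution ρ s.2.1 s.2.2 ≤ M.contribution x s.2.1 s.2.2 := by
    intro d
    rcases Set.eq_empty_or_nonempty {ρ : Fin N → ℝ | (∀ r, 0 ≤ ρ r) ∧ totalPower ρ = d} with h | h
    -- The slice is empty when `N = 0` and `d > 0`; the witness is then a dummy.
    · exact ⟨0, fun ρ h1 h2 => absurd (show ρ ∈ (∅ : Set _) from h ▸ ⟨h1, h2⟩) id⟩
    · obtain ⟨x, hx, hm⟩ := (isCompact_totalPower_eq N d).exists_isMaxOn h
        ((continuousOn_contribution M s.2).mono fun _ h => h.1)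
      exact ⟨x, fun ρ h1 h2 => ⟨hx.1, hx.2, hm ⟨h1, h2⟩⟩⟩
  choose x hx using hmax
  have hdom : ∀ ρ ∈ feasible (s.1 : ℕ),
      ∃ ρ' ∈ ((Finset.range (s.1 + 1)).image x).filter (· ∈ feasible (s.1 : ℕ)),
        totalPower ρ' = totalPower ρ ∧
          M.contribution ρ s.2.1 s.2.2 ≤ M.contribution ρ' s.2.1 s.2.2 := by
    rintro ρ ⟨h, d, hd, ht⟩
    obtain ⟨h1, h2, h3⟩ := hx d ρ h ht
    refine ⟨x d, Finset.mem_filter.mpr ⟨Finset.mem_image_of_mem _ ?_, h1, d, hd, h2⟩,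
      h2.trans ht.symm, h3⟩
    exact Finset.mem_range.mpr (Nat.lt_succ_of_le hd)
  refine ⟨_, ?_, fun ρ hρ => (Finset.mem_filter.mp hρ).2, hdom⟩
  obtain ⟨ρ, hρ, -⟩ := hdom 0 (zero_mem_feasible _)
  exact ⟨ρ, hρ⟩

end Rate

/-! ### The battery-level chain, its long-run rates and the optimal decision. -/

section LevelChain

/-- Law of the next battery level when `ρ` is used at level `e`. -/
def Model.levelStep (M : Model N) (e : M.Level) (ρ : Fin N → ℝ) : PMF M.Level :=
  M.arrivalLaw.map (M.nextLevel e ρ)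

/-- This lets an allocation be replaced by a better one of equal total power without changing the
future. -/
theorem Model.levelStep_congr (M : Model N) (e : M.Level) {ρ ρ' : Fin N → ℝ}
    (h : totalPower ρ = totalPower ρ') : M.levelStep e ρ = M.levelStep e ρ' := by
  have hnext : M.nextLevel e ρ = M.nextLevel e ρ' := by
    funext b
    simp only [Model.nextLevel, h]
  rw [Model.levelStep, hnext, Model.levelStep]

variable {M : Model N}

/-- Law of the next battery level given the state. -/
def Policy.stateKernel (μ : Policy M) (s : M.State) : PMF M.Level :=
  (μ.law s).bind (M.levelStep s.1)

/-- Transition kernel of the battery level. -/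
def Policy.levelKernel (μ : Policy M) (e : M.Level) : PMF M.Level :=
  M.channelLaw.bind fun c => μ.stateKernel (e, c)

/-- Expected secrecy rate given the battery level. -/
def Policy.levelReward (μ : Policy M) (e : M.Level) : ℝ :=
  expect M.channelLaw fun c => μ.stateReward (e, c)

/-- Law of the battery level in slot `k`. -/
def Policy.levelLaw (μ : Policy M) (e₀ : M.Level) : ℕ → PMF M.Level
  | 0 => PMF.pure e₀
  | k + 1 => (μ.levelLaw e₀ k).bind μ.levelKernel

theorem Policy.step_eq (μ : Policy M) (s : M.State) :
    μ.step s = (μ.stateKernel s).bind fun e => M.channelLaw.map fun c => (e, c) := by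
  simp only [Policy.step, Policy.stateKernel, Model.levelStep, PMF.map, PMF.bind_bind,
    PMF.pure_bind, Function.comp_def]

/-- The current channel is independent of the current battery level, so the level law determines the
state law. -/
theorem Policy.stateLaw_eq (μ : Policy M) (e₀ : M.Level) (k : ℕ) :
    μ.stateLaw e₀ k = (μ.levelLaw e₀ k).bind fun e => M.channelLaw.map fun c => (e, c) := by
  induction k with
  | zero => simp [Policy.stateLaw, Policy.levelLaw]
  | succ k ih =>
    rw [Policy.stateLaw, ih, Policy.levelLaw]
    simp only [Policy.levelKernel, PMF.bind_bind, PMF.bind_map, Function.comp_def,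
      Policy.step_eq]

theorem Policy.expect_levelLaw (μ : Policy M) (e₀ : M.Level) (k : ℕ) (f : M.Level → ℝ) :
    expect (μ.levelLaw e₀ k) f = ((transition μ.levelKernel) ^ k) f e₀ := by
  induction k generalizing f with
  | zero => simp [Policy.levelLaw, expect_pure]
  | succ k ih =>
    rw [Policy.levelLaw, expect_bind, pow_succ, Module.End.mul_apply, ← ih]
    rfl

theorem Policy.slotReward_eq (μ : Policy M) (e₀ : M.Level) (k : ℕ) :
    μ.slotReward e₀ k = ((transition μ.levelKernel) ^ k) μ.levelReward e₀ := by
  rw [← Policy.expect_levelLaw]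
  change expect (μ.stateLaw e₀ k) μ.stateReward = _
  rw [Policy.stateLaw_eq, expect_bind]
  simp only [expect_map]
  rfl

theorem Policy.levelProb_eq (μ : Policy M) (e₀ : M.Level) (k : ℕ) (e : M.Level) :
    μ.levelProb e₀ k e = ((transition μ.levelKernel) ^ k) (Pi.single e 1) e₀ := by
  rw [← Policy.expect_levelLaw, expect_single, Policy.levelProb, Policy.stateLaw_eq,
    PMF.map_bind]
  have hfst : ∀ e' : M.Level, (M.channelLaw.map fun c => (e', c)).map Prod.fst = PMF.pure e' :=
    fun e' => by rw [PMF.map_comp]; exact PMF.map_const _ _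
  simp_rw [hfst, PMF.bind_pure]

theorem Policy.tendsto_cesaro (μ : Policy M) {f a b : M.Level → ℝ}
    (ha : transition μ.levelKernel a = a) (hf : f = a + (transition μ.levelKernel b - b))
    (e₀ : M.Level) :
    Tendsto (fun K : ℕ =>
      (∑ k ∈ Finset.range (K + 1), ((transition μ.levelKernel) ^ k) f e₀) / ((K : ℝ) + 1)) atTop
      (nhds (a e₀)) := by
  have h := tendsto_pi_nhds.mp (tendsto_cesaro_of_decomposition
    (norm_transition_le μ.levelKernel) ha hf) e₀
  refine h.congr fun K => ?_
  rw [Pi.smul_apply, Finset.sum_apply, smul_eq_mul, div_eq_inv_mul]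

theorem Policy.averageRate_eq (μ : Policy M) {a b : M.Level → ℝ}
    (ha : transition μ.levelKernel a = a)
    (hf : μ.levelReward = a + (transition μ.levelKernel b - b)) (e₀ : M.Level) :
    μ.averageRate e₀ = max 0 (a e₀) := by
  rw [Policy.averageRate]
  simp_rw [Policy.slotReward_eq]
  rw [(μ.tendsto_cesaro ha hf e₀).liminf_eq]

/-- Decomposing each level's indicator shows that the lower limits in `steadyState` are true limits.
They may therefore be summed against the rewards, which lower limits alone would not allow. -/
theorem Policy.steadyRate_eq (μ : Policy M) {a b : M.Level → ℝ}
    (ha : transition μ.levelKernel a = a)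
    (hf : μ.levelReward = a + (transition μ.levelKernel b - b)) (e₀ : M.Level) :
    μ.steadyRate e₀ = a e₀ := by
  have hdec := fun e : M.Level => exists_fixed_add_coboundary
    (norm_transition_le μ.levelKernel) (Pi.single e 1 : M.Level → ℝ)
  choose α β hα hβ using hdec
  have hπ : ∀ e, Tendsto (fun K : ℕ =>
      (∑ k ∈ Finset.range (K + 1), μ.levelProb e₀ k e) / ((K : ℝ) + 1)) atTop
      (nhds (μ.steadyState e₀ e)) := by
    intro e
    have h := μ.tendsto_cesaro (hα e) (hβ e) e₀
    simp_rw [← Policy.levelProb_eq] at h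
    rwa [Policy.steadyState, h.liminf_eq]
  have hsum := tendsto_finsetSum (Finset.univ : Finset M.Level)
    fun e _ => (hπ e).mul_const (μ.levelReward e)
  refine tendsto_nhds_unique hsum ((μ.tendsto_cesaro ha hf e₀).congr fun K => ?_)
  simp_rw [div_mul_eq_mul_div, ← Finset.sum_div, Finset.sum_mul]
  rw [Finset.sum_comm]
  congr 1
  refine Finset.sum_congr rfl fun k _ => ?_
  simp_rw [Policy.levelProb_eq, ← Policy.expect_levelLaw, expect_single]
  rfl

/-- The policy that uses the allocation `σ s` in state `s`. -/
def Policy.ofDecision (σ : M.State → Fin N → ℝ) (hσ : ∀ s : M.State, σ s ∈ feasible (s.1 : ℕ)) :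
    Policy M where
  law s := PMF.pure (σ s)
  support_subset s := by simpa using hσ s

theorem Policy.stateKernel_ofDecision (σ : M.State → Fin N → ℝ)
    (hσ : ∀ s : M.State, σ s ∈ feasible (s.1 : ℕ)) (s : M.State) :
    (Policy.ofDecision σ hσ).stateKernel s = M.levelStep s.1 (σ s) :=
  PMF.pure_bind _ _

theorem Policy.stateReward_ofDecision (σ : M.State → Fin N → ℝ)
    (hσ : ∀ s : M.State, σ s ∈ feasible (s.1 : ℕ)) (s : M.State) :
    (Policy.ofDecision σ hσ).stateReward s = M.contribution (σ s) s.2.1 s.2.2 := by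
  classical
  rw [Policy.stateReward, tsum_eq_single (σ s)]
  · simp [Policy.ofDecision]
  · intro ρ hρ
    simp [Policy.ofDecision, PMF.pure_apply, hρ]

theorem Policy.discounted_eq_expect (μ : Policy M) (γ : ℝ) (u : M.Level → ℝ) (e : M.Level) :
    (1 - γ) * μ.levelReward e + γ * expect (μ.levelKernel e) u =
      expect M.channelLaw fun c =>
        (1 - γ) * μ.stateReward (e, c) + γ * expect (μ.stateKernel (e, c)) u := by
  rw [Policy.levelReward, Policy.levelKernel, expect_bind, ← expect_smul, ← expect_smul,
    ← expect_add]
  rfl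

/-- A randomized decision is not better than the best of the allocations it mixes. -/
theorem Policy.discounted_le (μ : Policy M) {γ : ℝ} (u : M.Level → ℝ) (s : M.State) {B : ℝ}
    (hB : ∀ ρ ∈ feasible (s.1 : ℕ),
      (1 - γ) * M.contribution ρ s.2.1 s.2.2 + γ * expect (M.levelStep s.1 ρ) u ≤ B) :
    (1 - γ) * μ.stateReward s + γ * expect (μ.stateKernel s) u ≤ B := by
  obtain ⟨C, hC⟩ := exists_contribution_bound M s
  -- A policy may mix infinitely many allocations; boundedness of the rate on the compact feasible
  -- set gives summability.
  have s1 : Summable fun ρ => (μ.law s ρ).toReal * M.contribution ρ s.2.1 s.2.2 :=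
    summable_toReal_mul _ fun ρ hρ => hC ρ (μ.support_subset s hρ)
  have s2 : Summable fun ρ => (μ.law s ρ).toReal * expect (M.levelStep s.1 ρ) u :=
    summable_toReal_mul _ fun ρ _ => abs_expect_le _ u
  have hs := (s1.mul_left (1 - γ)).add (s2.mul_left γ)
  have hfun : ∀ ρ, (1 - γ) * ((μ.law s ρ).toReal * M.contribution ρ s.2.1 s.2.2) +
      γ * ((μ.law s ρ).toReal * expect (M.levelStep s.1 ρ) u) = (μ.law s ρ).toReal *
        ((1 - γ) * M.contribution ρ s.2.1 s.2.2 + γ * expect (M.levelStep s.1 ρ) u) :=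
    fun ρ => by ring
  rw [Policy.stateReward, Policy.stateKernel, expect_bind_eq_tsum, ← tsum_mul_left,
    ← tsum_mul_left, ← (s1.mul_left (1 - γ)).tsum_add (s2.mul_left γ)]
  simp_rw [hfun] at hs ⊢
  exact tsum_toReal_mul_le _ hs fun ρ hρ => hB ρ (μ.support_subset s hρ)

/-- For every discount factor, one of finitely many deterministic decisions attains the optimal
discounted value `u`. -/
theorem exists_discounted_optimal {A : M.State → Finset (Fin N → ℝ)} (hne : ∀ s, (A s).Nonempty)
    (hfeas : ∀ s : M.State, ↑(A s) ⊆ feasible (N := N) (s.1 : ℕ))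
    (hdom : ∀ s : M.State, ∀ ρ ∈ feasible (s.1 : ℕ), ∃ ρ' ∈ A s, totalPower ρ' = totalPower ρ ∧
        M.contribution ρ s.2.1 s.2.2 ≤ M.contribution ρ' s.2.1 s.2.2)
    {γ : ℝ} (h0 : 0 ≤ γ) (h1 : γ < 1) :
    ∃ (σ : ∀ s, A s) (u : M.Level → ℝ),
      (∀ e, u e = (1 - γ) *
          (Policy.ofDecision (fun s => σ s) fun s => hfeas s (σ s).2).levelReward e +
        γ * expect ((Policy.ofDecision (fun s => σ s) fun s => hfeas s (σ s).2).levelKernel e) u) ∧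
      ∀ (ν : Policy M) (e : M.Level),
        (1 - γ) * ν.levelReward e + γ * expect (ν.levelKernel e) u ≤ u e := by
  obtain ⟨u, hu⟩ := exists_bellman_solution M.channelLaw (fun e c => A (e, c))
    (fun e c => hne (e, c)) (fun _ c ρ => M.contribution ρ c.1 c.2) M.levelStep h0 h1
  have hargmax := fun s : M.State => Finset.exists_mem_eq_sup' (hne s) fun ρ =>
    (1 - γ) * M.contribution ρ s.2.1 s.2.2 + γ * expect (M.levelStep s.1 ρ) u
  choose σ hσ hmax using hargmax
  refine ⟨fun s => ⟨σ s, hσ s⟩, u, fun e => ?_, fun ν e => ?_⟩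
  · rw [Policy.discounted_eq_expect, hu e]
    congr 1
    funext c
    rw [Policy.stateReward_ofDecision, Policy.stateKernel_ofDecision]
    exact hmax (e, c)
  · rw [Policy.discounted_eq_expect, hu e]
    refine expect_mono _ fun c => ν.discounted_le u (e, c) fun ρ hρ => ?_
    obtain ⟨ρ', hρ', ht, hle⟩ := hdom (e, c) ρ hρ
    rw [← M.levelStep_congr e ht]
    refine le_trans ?_ (Finset.le_sup' (fun ρ => (1 - γ) * M.contribution ρ c.1 c.2 +
      γ * expect (M.levelStep e ρ) u) hρ')
    have := mul_le_mul_of_nonneg_left hle (sub_pos.mpr h1).le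
    linarith

theorem exists_optimal_decision (M : Model N) :
    ∃ (σ : M.State → Fin N → ℝ) (hσ : ∀ s : M.State, σ s ∈ feasible (s.1 : ℕ)),
      (Policy.ofDecision σ hσ).IsOptimal := by
  choose A hne hfeas hdom using exists_dominating_actions M
  have hγ0 : ∀ n : ℕ, 0 ≤ 1 - 1 / ((n : ℝ) + 1) := fun n =>
    sub_nonneg.mpr ((div_le_one (by positivity)).mpr (by linarith [n.cast_nonneg (α := ℝ)]))
  have hγ1 : ∀ n : ℕ, 1 - 1 / ((n : ℝ) + 1) < 1 := fun n =>
    sub_lt_self _ (by positivity)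
  choose σ u hu hle using fun n : ℕ =>
    exists_discounted_optimal (M := M) hne hfeas hdom (hγ0 n) (hγ1 n)
  -- `τ` is fixed before `e₀` and `ν`, so one decision serves all initial levels and competitors.
  obtain ⟨τ, hτ⟩ := Finite.exists_infinite_fiber σ
  rw [Set.infinite_coe_iff] at hτ
  refine ⟨fun s => τ s, fun s => hfeas s (τ s).2, fun e₀ ν => ?_⟩
  set μ : Policy M := Policy.ofDecision (fun s => τ s) fun s => hfeas s (τ s).2 with hμ
  obtain ⟨a, b, ha, hab⟩ := exists_fixed_add_coboundary
    (norm_transition_le μ.levelKernel) μ.levelReward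
  obtain ⟨a', b', ha', hab'⟩ := exists_fixed_add_coboundary
    (norm_transition_le ν.levelKernel) ν.levelReward
  -- Here `1 - γ = 1 / (n + 1)`; the discounted value lies above `a'` and below `a`, up to the two
  -- errors.
  have hfreq : ∃ᶠ n : ℕ in atTop,
      a' e₀ ≤ a e₀ + (2 * ‖b‖ + 2 * ‖b'‖) * (1 / ((n : ℝ) + 1)) := by
    refine (Nat.frequently_atTop_iff_infinite.mpr hτ).mono fun n hn => ?_
    have hn' : σ n = τ := hn
    have h1 := le_of_discounted_supersolution (hγ0 n) (hγ1 n) ha' hab' (hle n ν) e₀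
    have h2 := le_of_discounted_subsolution (hγ0 n) (hγ1 n) ha hab
      (fun e => by rw [hμ, ← hn']; exact (hu n e).le) e₀
    linarith
  have hlim : Tendsto (fun n : ℕ => a e₀ + (2 * ‖b‖ + 2 * ‖b'‖) * (1 / ((n : ℝ) + 1))) atTop
      (nhds (a e₀)) := by
    simpa using ((tendsto_one_div_add_atTop_nhds_zero_nat (𝕜 := ℝ)).const_mul
      (2 * ‖b‖ + 2 * ‖b'‖)).const_add (a e₀)
  have hmain : a' e₀ ≤ a e₀ := ge_of_tendsto_of_frequently hlim hfreq
  rw [ν.averageRate_eq ha' hab', μ.averageRate_eq ha hab, ν.steadyRate_eq ha' hab',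
    μ.steadyRate_eq ha hab]
  exact ⟨max_le_max le_rfl hmain, hmain⟩

end LevelChain

end EHSecrecy

end

theorem theorem1 {N : ℕ} (M : EHSecrecy.Model N) :
    ∃ μ : EHSecrecy.Policy M,
      μ.IsOptimal ∧
      (∃ ρ : M.State → (Fin N → ℝ), ∀ (s : M.State) (x : Fin N → ℝ),
        μ.law s x = if x = ρ s then 1 else 0) ∧
      (∃ d : M.State → ℝ, ∀ (s : M.State) (t : ℝ),
        μ.transmitPower s t = if t = d s then 1 else 0) := by
  obtain ⟨σ, hσ, hopt⟩ := EHSecrecy.exists_optimal_decision M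
  refine ⟨_, hopt, ⟨σ, fun s x => ?_⟩, ⟨fun s => EHSecrecy.totalPower (σ s), fun s t => ?_⟩⟩
  · simp [EHSecrecy.Policy.ofDecision, PMF.pure_apply]
  · simp [EHSecrecy.Policy.transmitPower, EHSecrecy.Policy.ofDecision, PMF.pure_map,
      PMF.pure_apply]
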